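/- Let $T>0$, let $\mathcal S=\{S_1,\dots,S_q\}$ be a finite set of states, and let $Y=\{Y(t),\ t\in[0,T]\}$ be a (jointly measurable) random process with values in $\mathcal S$ that satisfies $$\mathbf H_1:\quad \lim_{h\to 0}\mathbb P[Y(t)\neq Y(t+h)]=0\quad\text{for all } t\in[0,T]$$ (with $t+h\in[0,T]$). Let $w_1,\dots,w_q>0$, and let $\mathbb H=L^2[0,T]^q$ be the Hilbert space with inner product $\langle \mathbf f,\mathbf g\rangle_{\mathbb H}=\sum_{j=1}^q w_j\int_0^T f_j(t)g_j(t)\,dt$. Put $X_j(t)=\mathbf 1_{\{Y(t)=S_j\}}$, $\mathbf X=(X_1,\dots,X_q)\in\mathbb H$, $p_j(t)=\mathbb P[Y(t)=S_j]$, $\mathbf p=(p_1,\dots,p_q)\in\mathbb H$, and write $(\mathbf u\otimes \mathbf v)\boldsymbol\phi=\langle \mathbf u,\boldsymbol\phi\rangle_{\mathbb H}\,\mathbf v$ for $\mathbf u,\mathbf v,\boldsymbol\phi\in\mathbb H$. Let $\boldsymbol\Gamma=\mathbb E[(\mathbf X-\mathbf p)\otimes(\mathbf X-\mathbf p)]$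 be the covariance operator of $\mathbf X$ on $\mathbb H$. Let $Y_1,Y_2,\dots$ be independent (jointly measurable) processes with the same finite-dimensional distributions as $Y$, let $\mathbf X_i$ be the vector of binary trajectories of $Y_i$, and set $$\widehat{\mathbf p}=\frac1n\sum_{i=1}^n\mathbf X_i,\qquad \widehat{\boldsymbol\Gamma}=\frac1n\sum_{i=1}^n\mathbf X_i\otimes\mathbf X_i-\widehat{\mathbf p}\otimes\widehat{\mathbf p}.$$ Then, as $n\to\infty$: 1. $\|\widehat{\mathbf p}-\mathbf p\|_{\mathbb H}\to0$ almost surely and $\|\widehat{\boldsymbol\Gamma}-\boldsymbol\Gamma\|_{op}\to0$ almost surely, where $\|\cdot\|_{op}$ is the operator norm induced by the norm of $\mathbb H$; 2. $\sqrt n\,(\widehat{\mathbf p}-\mathbf p)$ converges in distribution in $\mathbb H$ to a centred Gaussian random element of $\mathbb H$, and $\sqrt n\,(\widehat{\boldsymbol\Gamma}-\boldsymbol\Gamma)$ is a Hilbert–Schmidt operator and converges in distribution, in the space of Hilbert–Schmidt operators on $\mathbb H$ with its Hilbert–Schmidt norm (hence also in operator norm), to a centred Gaussian random element of that space. -/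

import Mathlib

open MeasureTheory ProbabilityTheory Filter Topology
open scoped ENNReal

noncomputable section

namespace CategoricalFDA

/-! ### The Hilbert space of Hilbert–Schmidt operators -/

section HilbertSchmidt

variable (E : Type*) [NormedAddCommGroup E] [InnerProductSpace ℝ E] [CompleteSpace E]

/-- Index set of a fixed Hilbert basis of `E`. -/
def basisIndex : Set E := (exists_hilbertBasis ℝ E).choose

/-- A fixed Hilbert basis (complete orthonormal system) of `E`. -/
def someBasis : HilbertBasis (basisIndex E) ℝ E := (exists_hilbertBasis ℝ E).choose_spec.choose

/-- The bounded operators `A` on `E` with `∑ i, ‖A (e i)‖ ^ 2 < ∞`, `e` a Hilbert basis of `E`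
(neither the condition nor the value of the sum depends on the choice of `e`). -/
def hilbertSchmidtSubmodule : Submodule ℝ (E →L[ℝ] E) where
  carrier := {A | Summable fun i => ‖A (someBasis E i)‖ ^ 2}
  zero_mem' := by simp [summable_zero]
  add_mem' := by
    intro A B hA hB
    refine Summable.of_nonneg_of_le (fun i => by positivity) (fun i => ?_)
      ((hA.mul_left 2).add (hB.mul_left 2))
    have h := norm_add_le (A (someBasis E i)) (B (someBasis E i))
    rw [add_apply]
    nlinarith [sq_nonneg (‖A (someBasis E i)‖ - ‖B (someBasis E i)‖),
      norm_nonneg (A (someBasis E i) + B (someBasis E i))]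
  smul_mem' := by
    intro c A hA
    have h : Summable fun i => ‖c‖ ^ 2 * ‖A (someBasis E i)‖ ^ 2 := hA.mul_left _
    simpa [norm_smul, mul_pow] using h

/-- The type of Hilbert–Schmidt operators on `E`; it carries the Hilbert–Schmidt norm, not the
operator norm. -/
def HilbertSchmidt : Type _ := ↥(hilbertSchmidtSubmodule E)

instance : AddCommGroup (HilbertSchmidt E) :=
  inferInstanceAs (AddCommGroup ↥(hilbertSchmidtSubmodule E))

instance : Module ℝ (HilbertSchmidt E) :=
  inferInstanceAs (Module ℝ ↥(hilbertSchmidtSubmodule E))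

variable {E}

/-- The bounded operator underlying a Hilbert–Schmidt operator. -/
def HilbertSchmidt.toCLM (A : HilbertSchmidt E) : E →L[ℝ] E := A.1

lemma HilbertSchmidt.memℓp (A : HilbertSchmidt E) :
    Memℓp (fun i : basisIndex E => A.toCLM (someBasis E i)) 2 := by
  refine memℓp_gen ?_
  have h : Summable fun i => ‖A.toCLM (someBasis E i)‖ ^ 2 := A.2
  simpa using h

variable (E) in
/-- The linear map sending `A` to the square-summable family `(A (e i))_i`. -/
def HilbertSchmidt.toLp : HilbertSchmidt E →ₗ[ℝ] lp (fun _ : basisIndex E => E) 2 where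
  toFun A := ⟨fun i => A.toCLM (someBasis E i), A.memℓp⟩
  map_add' _ _ := rfl
  map_smul' _ _ := rfl

lemma HilbertSchmidt.toLp_injective : Function.Injective (HilbertSchmidt.toLp E) := by
  intro A B h
  refine Subtype.ext ?_
  refine ContinuousLinearMap.ext_on
    (Submodule.dense_iff_topologicalClosure_eq_top.2 (someBasis E).dense_span) ?_
  rintro _ ⟨i, rfl⟩
  exact congrFun (congrArg Subtype.val h) i

/-- The Hilbert–Schmidt norm. -/
instance : NormedAddCommGroup (HilbertSchmidt E) :=
  NormedAddCommGroup.induced _ _ (HilbertSchmidt.toLp E) HilbertSchmidt.toLp_injective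

instance : NormedSpace ℝ (HilbertSchmidt E) :=
  NormedSpace.induced ℝ _ _ (HilbertSchmidt.toLp E)

lemma HilbertSchmidt.norm_sq (A : HilbertSchmidt E) :
    ‖A‖ ^ 2 = ∑' i, ‖A.toCLM (someBasis E i)‖ ^ 2 := by
  have h := lp.norm_rpow_eq_tsum (p := 2) (by norm_num) (HilbertSchmidt.toLp E A)
  simp only [ENNReal.toReal_ofNat, Real.rpow_ofNat] at h
  exact h

instance : MeasurableSpace (HilbertSchmidt E) := borel _

instance : BorelSpace (HilbertSchmidt E) := ⟨rfl⟩

end HilbertSchmidt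

/-! ### Asymptotic normality -/

/-- The sequence `Z` of `E`-valued random elements is asymptotically Gaussian: it converges in
distribution to a centred Gaussian random element of `E`. -/
def AsymptoticallyGaussian {Ω : Type*} [MeasurableSpace Ω] (P : Measure Ω)
    [IsProbabilityMeasure P] {E : Type*} [NormedAddCommGroup E] [NormedSpace ℝ E]
    [MeasurableSpace E] [BorelSpace E] (Z : ℕ → Ω → E) : Prop :=
  ∃ (ν : Measure E) (_ : IsGaussian ν), (∀ L : StrongDual ℝ E, ∫ x, L x ∂ν = 0) ∧
    TendstoInDistribution Z atTop id (fun _ => P) ν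

/-! ### The weighted product space -/

/-- Lebesgue measure on the interval `[0,T]`. -/
def lebesgue (T : ℝ) : Measure (Set.Icc (0 : ℝ) T) := (volume : Measure ℝ).comap Subtype.val

instance (T : ℝ) : IsFiniteMeasure (lebesgue T) := by
  refine ⟨?_⟩
  rw [lebesgue, (MeasurableEmbedding.subtype_coe measurableSet_Icc).comap_apply]
  exact (measure_mono (Subtype.coe_image_subset _ _)).trans_lt measure_Icc_lt_top

/-- `L²[0,T] × ⋯ × L²[0,T]` with the inner product `∑ j, w j * ∫ t in [0,T], f j t * g j t`, for
positive weights `w`. The `j`-th factor is `L²[0,T]` with Lebesgue measure multiplied by `w j`: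
as `0 < w j` this is the same set of functions modulo the same null sets, and the inner product is
multiplied by `w j`; see `inner_eq`. -/
def WeightedL2 (T : ℝ) {q : ℕ} (w : Fin q → ℝ) : Type :=
  PiLp 2 fun j : Fin q =>
    Lp ℝ 2 (ENNReal.ofReal (w j) • lebesgue T)

section WeightedL2

variable {T : ℝ} {q : ℕ} {w : Fin q → ℝ}

instance : NormedAddCommGroup (WeightedL2 T w) :=
  inferInstanceAs (NormedAddCommGroup (PiLp 2 fun j : Fin q =>
    Lp ℝ 2 (ENNReal.ofReal (w j) • lebesgue T)))

instance : InnerProductSpace ℝ (WeightedL2 T w) :=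
  inferInstanceAs (InnerProductSpace ℝ (PiLp 2 fun j : Fin q =>
    Lp ℝ 2 (ENNReal.ofReal (w j) • lebesgue T)))

instance : CompleteSpace (WeightedL2 T w) :=
  inferInstanceAs (CompleteSpace (PiLp 2 fun j : Fin q =>
    Lp ℝ 2 (ENNReal.ofReal (w j) • lebesgue T)))

instance : MeasurableSpace (WeightedL2 T w) := borel _

instance : BorelSpace (WeightedL2 T w) := ⟨rfl⟩

/-- The `j`-th component. -/
def WeightedL2.component (f : WeightedL2 T w) (j : Fin q) :
    Lp ℝ 2 (ENNReal.ofReal (w j) • lebesgue T) :=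
  WithLp.ofLp f j

lemma WeightedL2.inner_eq (hw : ∀ j, 0 < w j) (f g : WeightedL2 T w) :
    inner ℝ f g = ∑ j, w j * ∫ t, f.component j t * g.component j t ∂lebesgue T := by
  have h : inner ℝ f g = ∑ j, inner ℝ (f.component j) (g.component j) := PiLp.inner_apply f g
  rw [h]
  refine Finset.sum_congr rfl fun j _ => ?_
  rw [L2.inner_def, integral_smul_measure, ENNReal.toReal_ofReal (hw j).le, smul_eq_mul]
  congr 1
  refine integral_congr_ae (ae_of_all _ fun t => ?_)
  simp [mul_comm]

/-- The element of `WeightedL2 T w` with components the classes of the bounded measurable functions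
`f j`. -/
def WeightedL2.ofBounded (T : ℝ) {q : ℕ} (w : Fin q → ℝ) (f : Fin q → Set.Icc (0 : ℝ) T → ℝ)
    (hf : ∀ j, Measurable (f j)) (hb : ∀ j t, ‖f j t‖ ≤ 1) : WeightedL2 T w :=
  WithLp.toLp 2 fun j =>
    haveI : IsFiniteMeasure (ENNReal.ofReal (w j) • lebesgue T) :=
      Measure.smul_finite _ ENNReal.ofReal_ne_top
    (MemLp.of_bound (hf j).aestronglyMeasurable 1 (ae_of_all _ (hb j))).toLp (f j)

end WeightedL2

/-! ### Categorical trajectories -/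

/-- A random categorical trajectory on `[0,T]` with states labelled by `Fin q`: a (jointly
measurable) process `(Y t)`, `t ∈ [0,T]`. -/
structure CategoricalProcess (Ω : Type*) [MeasurableSpace Ω] (T : ℝ) (q : ℕ) where
  /-- `Y ω t` is the state at time `t`. -/
  toFun : Ω → Set.Icc (0 : ℝ) T → Fin q
  measurable_uncurry : Measurable (Function.uncurry toFun)

namespace CategoricalProcess

variable {Ω : Type*} [MeasurableSpace Ω] {T : ℝ} {q : ℕ}

/-- Continuity in probability: `lim_{s → t} ℙ(Y t ≠ Y s) = 0` for all `t ∈ [0,T]`. -/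
def ContinuousInProbability (Y : CategoricalProcess Ω T q) (P : Measure Ω) : Prop :=
  ∀ t : Set.Icc (0 : ℝ) T,
    Tendsto (fun s : Set.Icc (0 : ℝ) T => P {ω | Y.toFun ω t ≠ Y.toFun ω s}) (𝓝 t) (𝓝 0)

/-- The binary trajectory `X_j(t) = 1` if `Y(t) = j` and `0` otherwise. -/
def binary (Y : CategoricalProcess Ω T q) (ω : Ω) (j : Fin q) (t : Set.Icc (0 : ℝ) T) : ℝ :=
  if Y.toFun ω t = j then 1 else 0

/-- The random element `X = (X_1, …, X_q)` of the weighted product space. -/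
def X (Y : CategoricalProcess Ω T q) (w : Fin q → ℝ) (ω : Ω) : WeightedL2 T w :=
  WeightedL2.ofBounded T w (Y.binary ω)
    (fun j => Measurable.ite
      ((Y.measurable_uncurry.comp measurable_prodMk_left) (measurableSet_singleton j))
      measurable_const measurable_const)
    (fun j t => by unfold binary; split_ifs <;> simp)

variable (P : Measure Ω) [IsProbabilityMeasure P]

/-- The probability of occurrence `p_j(t) = ℙ(Y(t) = j)`. -/
def prob (Y : CategoricalProcess Ω T q) (j : Fin q) (t : Set.Icc (0 : ℝ) T) : ℝ :=
  P.real {ω | Y.toFun ω t = j}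

/-- The mean `p = (p_1, …, p_q)` as an element of the weighted product space. -/
def p (Y : CategoricalProcess Ω T q) (w : Fin q → ℝ) : WeightedL2 T w :=
  WeightedL2.ofBounded T w (Y.prob P)
    (fun j => (measurable_measure_prodMk_right
      (Y.measurable_uncurry (measurableSet_singleton j))).ennreal_toReal)
    (fun j t => by
      unfold prob
      rw [Real.norm_of_nonneg measureReal_nonneg]
      exact measureReal_le_one)

end CategoricalProcess

/-- The tensor product `(u ⊗ v) φ = ⟪u, φ⟫ v`. -/
def tensor {E : Type*} [NormedAddCommGroup E] [InnerProductSpace ℝ E] (u v : E) : E →L[ℝ] E :=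
  InnerProductSpace.rankOne ℝ v u

lemma tensor_apply {E : Type*} [NormedAddCommGroup E] [InnerProductSpace ℝ E] (u v φ : E) :
    tensor u v φ = inner ℝ u φ • v := rfl

/-- The covariance operator `Γ = 𝔼[(X - p) ⊗ (X - p)]`, that is
`Γ φ = 𝔼[⟪X - p, φ⟫ (X - p)]`. -/
def CategoricalProcess.Γ {Ω : Type*} [MeasurableSpace Ω] {T : ℝ} {q : ℕ}
    (P : Measure Ω) [IsProbabilityMeasure P] (Y : CategoricalProcess Ω T q) (w : Fin q → ℝ) :
    WeightedL2 T w →L[ℝ] WeightedL2 T w :=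
  ∫ ω, tensor (Y.X w ω - Y.p P w) (Y.X w ω - Y.p P w) ∂P

/-! ### Estimators -/

section Estimators

variable {Ω : Type*} [MeasurableSpace Ω] {T : ℝ} {q : ℕ}

/-- The empirical mean of the first `n` trajectories. -/
def empiricalMean (Y : ℕ → CategoricalProcess Ω T q) (w : Fin q → ℝ) (n : ℕ) (ω : Ω) :
    WeightedL2 T w :=
  (n : ℝ)⁻¹ • ∑ i ∈ Finset.range n, (Y i).X w ω

/-- The empirical covariance operator of the first `n` trajectories. -/
def empiricalCov (Y : ℕ → CategoricalProcess Ω T q) (w : Fin q → ℝ) (n : ℕ) (ω : Ω) :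
    WeightedL2 T w →L[ℝ] WeightedL2 T w :=
  (n : ℝ)⁻¹ • ∑ i ∈ Finset.range n, tensor ((Y i).X w ω) ((Y i).X w ω)
    - tensor (empiricalMean Y w n ω) (empiricalMean Y w n ω)

/-- `Y 0, Y 1, …` are independent copies of the categorical process `Y₀`: they are independent and
have the same finite-dimensional distributions as `Y₀` (independence and equality in law are with
respect to the product σ-algebra on the set of trajectories). -/
structure IsIIDSample (P : Measure Ω) (Y₀ : CategoricalProcess Ω T q)
    (Y : ℕ → CategoricalProcess Ω T q) : Prop where
  indep : iIndepFun (fun i => (Y i).toFun) P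
  identDistrib : ∀ i, IdentDistrib (Y i).toFun Y₀.toFun P P

end Estimators

end CategoricalFDA

end

/-! Both statements are the strong law and the central limit theorem for bounded i.i.d. elements of
a separable Hilbert space, used twice: for `X_i` in `ℍ`, and for the centred squares `(X_i - p) ⊗
(X_i - p)` in the Hilbert–Schmidt operators, which form a separable Hilbert space too. By
`sampleCov_eq` the empirical covariance is the mean of the centred squares minus `(p̂ - p) ⊗ (p̂ -
p)`. This correction vanishes almost surely, and it is negligible even after multiplication by `√n`,
because `𝔼‖√n (p̂ - p)‖²` is bounded in `n`.

The Hilbert-space central limit theorem is Prokhorov's argument. The second moments of the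
coordinates of the normalized sums are bounded, uniformly in `n`, by the summable second moments of
the coordinates of one summand, whence tightness. The real central limit theorem fixes every
one-dimensional marginal of a cluster point, so the cluster point is unique and Gaussian.

The delicate point is measurability: independence and equality in law are given only on the product
σ-algebra of trajectories, for which time integrals need not be measurable. Here continuity in
probability enters. Trajectories sampled at finitely many times give measurable elements converging
in probability to `X`, so `X` is almost surely one measurable function of the trajectory, the same
for every copy (`exists_measurable_X_ae_eq`). -/

namespace CategoricalFDA

/-! ### Tightness in Hilbert spaces -/

/-- A set of measures on a complete metric space is tight as soon as, for every `δ`, its elements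
are uniformly almost concentrated on the `δ`-neighbourhood of a compact set. -/
lemma isTightMeasureSet_of_cthickening {E : Type*} [MetricSpace E] [CompleteSpace E]
    [MeasurableSpace E] {S : Set (Measure E)}
    (h : ∀ ε : ℝ≥0∞, 0 < ε → ∀ δ : ℝ, 0 < δ → ∃ C : Set E, IsCompact C ∧
      ∀ μ ∈ S, μ (Metric.cthickening δ C)ᶜ ≤ ε) :
    IsTightMeasureSet S := by
  rw [isTightMeasureSet_iff_exists_isCompact_measure_compl_le]
  intro ε hε
  obtain ⟨e, he, hsum⟩ := ENNReal.exists_pos_sum_of_countable' hε.ne' ℕ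
  choose C hC hμ using fun j : ℕ => h (e j) (he j) (1 / ((j : ℝ) + 1)) (by positivity)
  -- Closed, and totally bounded because a finite net of `C j` at scale `r / 2` is an `r`-net of its
  -- thickening once `1 / (j + 1) < r / 2`. The masses lost add up to at most `∑ e j < ε`.
  refine ⟨⋂ j : ℕ, Metric.cthickening (1 / ((j : ℝ) + 1)) (C j), ?_, fun μ hμS => ?_⟩
  · refine isCompact_iff_totallyBounded_isComplete.2 ⟨?_,
      (isClosed_iInter fun j => Metric.isClosed_cthickening).isComplete⟩
    refine Metric.totallyBounded_iff.2 fun r hr => ?_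
    obtain ⟨j, hj⟩ := exists_nat_one_div_lt (half_pos hr)
    obtain ⟨t, ht, hCt⟩ := Metric.totallyBounded_iff.1 (hC j).totallyBounded (r / 2) (half_pos hr)
    refine ⟨t, ht, fun x hx => ?_⟩
    have hx' := Metric.cthickening_subset_thickening' (half_pos hr) hj (C j) (Set.mem_iInter.1 hx j)
    obtain ⟨y, hy, hxy⟩ := Metric.mem_thickening_iff.1 hx'
    obtain ⟨z, hz, hyz⟩ := Set.mem_iUnion₂.1 (hCt hy)
    refine Set.mem_iUnion₂.2 ⟨z, hz, ?_⟩
    rw [Metric.mem_ball] at hyz ⊢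
    linarith [dist_triangle x y z]
  · rw [Set.compl_iInter]
    exact (measure_iUnion_le _).trans ((ENNReal.tsum_le_tsum fun j => hμ j μ hμS).trans hsum.le)

lemma measure_lt_norm_le_lintegral {Ω F : Type*} [MeasurableSpace Ω] [NormedAddCommGroup F]
    (μ : Measure Ω) {f : Ω → F} (hf : AEMeasurable (fun x => ‖f x‖ₑ) μ) {r : ℝ} (hr : 0 < r) :
    μ {x | r < ‖f x‖} ≤ (∫⁻ x, ‖f x‖ₑ ^ 2 ∂μ) / ENNReal.ofReal (r ^ 2) := by
  refine le_trans (measure_mono fun x hx => ?_)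
    (meas_ge_le_lintegral_div (ε := ENNReal.ofReal (r ^ 2)) (hf.pow_const 2)
      (ENNReal.ofReal_pos.2 (by positivity)).ne' ENNReal.ofReal_ne_top)
  have hx' : r < ‖f x‖ := hx
  change ENNReal.ofReal (r ^ 2) ≤ ‖f x‖ₑ ^ 2
  rw [← ofReal_norm, ← ENNReal.ofReal_pow (norm_nonneg _)]
  exact ENNReal.ofReal_le_ofReal (by gcongr)

section HilbertBasis

variable {ι E : Type*} [NormedAddCommGroup E] [InnerProductSpace ℝ E]

/-- Distinct basis vectors are `√2` apart, so the balls of radius `1 / 2` around them are disjoint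
open sets. -/
lemma hilbertBasis_countable [TopologicalSpace.SeparableSpace E] (b : HilbertBasis ι ℝ E) :
    Countable ι := by
  refine Pairwise.countable_of_isOpen_disjoint (s := fun i => Metric.ball (b i) (1 / 2 : ℝ)) ?_
    (fun i => Metric.isOpen_ball) (fun i => ⟨b i, Metric.mem_ball_self (by norm_num)⟩)
  intro i j hij
  refine Metric.ball_disjoint_ball ?_
  have h : ‖b i - b j‖ * ‖b i - b j‖ = 2 := by
    rw [norm_sub_mul_self_real, b.orthonormal.2 hij]
    simp [b.orthonormal.1]; norm_num
  rw [dist_eq_norm]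
  nlinarith [norm_nonneg (b i - b j)]

lemma hasSum_norm_inner_sq (b : HilbertBasis ι ℝ E) (x : E) :
    HasSum (fun i => ‖inner ℝ (b i) x‖ ^ 2) (‖x‖ ^ 2) := by
  have h := b.hasSum_inner_mul_inner x x
  rw [real_inner_self_eq_norm_sq] at h
  simpa only [real_inner_comm x, Real.norm_eq_abs, sq_abs, ← sq] using h

lemma enorm_sq_eq_tsum (b : HilbertBasis ι ℝ E) (x : E) :
    ‖x‖ₑ ^ 2 = ∑' i, ‖inner ℝ (b i) x‖ₑ ^ 2 := by
  have h := hasSum_norm_inner_sq b x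
  simp_rw [← ofReal_norm, ← ENNReal.ofReal_pow (norm_nonneg _)]
  rw [← h.tsum_eq, ENNReal.ofReal_tsum_of_nonneg (fun i => by positivity) h.summable]

/-- Parseval for the truncation error; integrated, it becomes the tail of a convergent series. -/
lemma enorm_sub_sum_sq (b : HilbertBasis ι ℝ E) (s : Finset ι) (x : E) :
    ‖x - ∑ i ∈ s, inner ℝ (b i) x • b i‖ₑ ^ 2 = ∑' i : {i // i ∉ s}, ‖inner ℝ (b i) x‖ₑ ^ 2 := by
  classical
  rw [enorm_sq_eq_tsum b]
  refine Eq.trans (tsum_congr fun i => ?_)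
    (tsum_subtype {i | i ∉ s} fun i => ‖inner ℝ (b i) x‖ₑ ^ 2).symm
  rw [inner_sub_right, inner_sum]
  simp_rw [inner_smul_right, orthonormal_iff_ite.1 b.orthonormal]
  by_cases hi : i ∈ s <;> simp [hi]

variable [CompleteSpace E] [SecondCountableTopology E] [MeasurableSpace E] [BorelSpace E]

/-- A set of measures on a separable Hilbert space is tight if the second moments of the
coordinates in some Hilbert basis are dominated by a summable family. -/
lemma isTightMeasureSet_of_tsum_secondMoment (b : HilbertBasis ι ℝ E) {S : Set (Measure E)}
    {c : ι → ℝ≥0∞} (hc : ∑' i, c i ≠ ∞)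
    (h : ∀ μ ∈ S, ∀ i, ∫⁻ x, ‖inner ℝ (b i) x‖ₑ ^ 2 ∂μ ≤ c i) :
    IsTightMeasureSet S := by
  have := hilbertBasis_countable b
  have hsecond (μ) (hμ : μ ∈ S) : ∫⁻ x, ‖x‖ₑ ^ 2 ∂μ ≤ ∑' i, c i := by
    simp_rw [enorm_sq_eq_tsum b]
    rw [lintegral_tsum fun i => by fun_prop]
    exact ENNReal.tsum_le_tsum (h μ hμ)
  have htail (μ) (hμ : μ ∈ S) (s : Finset ι) :
      ∫⁻ x, ‖x - ∑ i ∈ s, inner ℝ (b i) x • b i‖ₑ ^ 2 ∂μ ≤ ∑' i : {i // i ∉ s}, c i := by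
    simp_rw [enorm_sub_sum_sq b]
    rw [lintegral_tsum fun i => by fun_prop]
    exact ENNReal.tsum_le_tsum fun i => h μ hμ i
  refine isTightMeasureSet_of_cthickening fun ε hε δ hδ => ?_
  obtain ⟨R, hR, hRε⟩ : ∃ R : ℝ, 0 < R ∧ (∑' i, c i) / ENNReal.ofReal (R ^ 2) ≤ ε / 2 := by
    have h1 : Tendsto (fun R : ℝ => (∑' i, c i) / ENNReal.ofReal (R ^ 2)) atTop (𝓝 0) := by
      rw [← ENNReal.div_top (a := ∑' i, c i)]
      exact ENNReal.Tendsto.const_div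
        (ENNReal.tendsto_ofReal_atTop.comp (tendsto_pow_atTop two_ne_zero)) (Or.inr hc)
    exact ((eventually_gt_atTop 0).and (h1.eventually_le_const (ENNReal.half_pos hε.ne'))).exists
  obtain ⟨s, hs⟩ : ∃ s : Finset ι, (∑' i : {i // i ∉ s}, c i) / ENNReal.ofReal (δ ^ 2) ≤ ε / 2 := by
    have h1 := ENNReal.Tendsto.div_const (ENNReal.tendsto_tsum_compl_atTop_zero hc)
      (b := ENNReal.ofReal (δ ^ 2)) (Or.inr (ENNReal.ofReal_pos.2 (by positivity)).ne')
    rw [ENNReal.zero_div] at h1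
    exact (h1.eventually_le_const (ENNReal.half_pos hε.ne')).exists
  -- The image of a cube: coordinates are bounded by the norm, so a point of norm at most `R`
  -- truncates into it. Chebyshev bounds the two exceptional events, large norm and large truncation
  -- error.
  refine ⟨(fun a : s → ℝ => ∑ i, a i • b i) '' Metric.closedBall 0 R,
    (isCompact_closedBall _ _).image (by fun_prop), fun μ hμ => ?_⟩
  calc μ (Metric.cthickening δ ((fun a : s → ℝ => ∑ i, a i • b i) '' Metric.closedBall 0 R))ᶜ
      ≤ μ ({x | R < ‖x‖} ∪ {x | δ < ‖x - ∑ i ∈ s, inner ℝ (b i) x • b i‖}) := by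
        refine measure_mono fun x hx => ?_
        by_contra hx'
        simp only [Set.mem_union, Set.mem_ofPred_eq, not_or, not_lt] at hx'
        refine hx (Metric.mem_cthickening_of_dist_le x (∑ i ∈ s, inner ℝ (b i) x • b i) δ _
          ⟨fun i => inner ℝ (b i) x, ?_, ?_⟩ (by rw [dist_eq_norm]; exact hx'.2))
        · rw [mem_closedBall_zero_iff, pi_norm_le_iff_of_nonneg hR.le]
          intro i
          refine (norm_inner_le_norm _ _).trans ?_
          rw [b.orthonormal.1, one_mul]
          exact hx'.1
        · exact Finset.sum_coe_sort s fun i => inner ℝ (b i) x • b i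
    _ ≤ ε / 2 + ε / 2 := by
        refine (measure_union_le _ _).trans (add_le_add ?_ ?_)
        · exact (measure_lt_norm_le_lintegral μ (f := fun x => x) (by fun_prop) hR).trans
            ((ENNReal.div_le_div_right (hsecond μ hμ) _).trans hRε)
        · exact (measure_lt_norm_le_lintegral μ (by fun_prop) hδ).trans
            ((ENNReal.div_le_div_right (htail μ hμ s) _).trans hs)
    _ = ε := ENNReal.add_halves ε

end HilbertBasis

/-! ### The central limit theorem in separable Hilbert spaces -/

section CentralLimit

variable {Ω E : Type*} [MeasurableSpace Ω] {P : Measure Ω} [IsProbabilityMeasure P]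

/-- For `n > 0` the left side is exactly the variance of `X 0`; for `n = 0` it vanishes since `√0 =
0`. The uniformity in `n` is what yields tightness. -/
lemma lintegral_enorm_normalizedSum_le {X : ℕ → Ω → ℝ} (hX : MemLp (X 0) 2 P)
    (hindep : iIndepFun X P) (hident : ∀ i, IdentDistrib (X i) (X 0) P P) (n : ℕ) :
    ∫⁻ ω, ‖√(n : ℝ) * ((n : ℝ)⁻¹ * ∑ i ∈ Finset.range n, X i ω - P[X 0])‖ₑ ^ 2 ∂P
      ≤ ∫⁻ ω, ‖X 0 ω‖ₑ ^ 2 ∂P := by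
  rcases Nat.eq_zero_or_pos n with rfl | hn
  · simp
  have hn' : (0 : ℝ) < n := by exact_mod_cast hn
  have hL (i : ℕ) : MemLp (X i) 2 P := (hident i).memLp_iff.2 hX
  have hsum : MemLp (∑ i ∈ Finset.range n, X i) 2 P := memLp_finsetSum' _ fun i _ => hL i
  set U : Ω → ℝ := fun ω => (√(n : ℝ) * (n : ℝ)⁻¹) * (∑ i ∈ Finset.range n, X i) ω with hU
  have hUL : MemLp U 2 P := hsum.const_mul _
  have hmean : P[U] = √(n : ℝ) * P[X 0] := by
    rw [hU, integral_const_mul]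
    simp only [Finset.sum_apply]
    rw [integral_finsetSum _ fun i _ => (hL i).integrable (by norm_num)]
    simp_rw [fun i => (hident i).integral_eq]
    rw [Finset.sum_const, Finset.card_range, nsmul_eq_mul]
    field_simp
  have hvar : Var[U; P] = Var[X 0; P] := by
    rw [hU, variance_const_mul, IndepFun.variance_sum (fun i _ => hL i)
      fun i _ j _ hij => hindep.indepFun hij]
    simp_rw [fun i => (hident i).variance_eq]
    rw [Finset.sum_const, Finset.card_range, nsmul_eq_mul, mul_pow, Real.sq_sqrt hn'.le]
    field_simp
  calc ∫⁻ ω, ‖√(n : ℝ) * ((n : ℝ)⁻¹ * ∑ i ∈ Finset.range n, X i ω - P[X 0])‖ₑ ^ 2 ∂P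
      = evariance U P := by
        rw [evariance, hmean]
        refine lintegral_congr fun ω => ?_
        rw [hU]
        simp only [Finset.sum_apply]
        congr 2
        ring
    _ = evariance (X 0) P := by
        rw [← hUL.ofReal_variance_eq, ← hX.ofReal_variance_eq, hvar]
    _ ≤ ∫⁻ ω, ‖X 0 ω‖ₑ ^ 2 ∂P := by
        rw [evariance_def' hX.1]
        exact tsub_le_self

/-- The one-dimensional central limit theorem for the normalized sample mean. -/
lemma tendstoInDistribution_normalizedSum {X : ℕ → Ω → ℝ} (hX : MemLp (X 0) 2 P)
    (hindep : iIndepFun X P) (hident : ∀ i, IdentDistrib (X i) (X 0) P P) :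
    TendstoInDistribution
      (fun (n : ℕ) ω => √(n : ℝ) * ((n : ℝ)⁻¹ * ∑ i ∈ Finset.range n, X i ω - P[X 0])) atTop id
      (fun _ => P) (gaussianReal 0 Var[X 0; P].toNNReal) := by
  have h := tendstoInDistribution_inv_sqrt_mul_sum_sub (P' := gaussianReal 0 Var[X 0; P].toNNReal)
    (Y := id) HasLaw.id hX hindep hident
  convert h using 3 with n ω
  rcases Nat.eq_zero_or_pos n with rfl | hn
  · simp
  have hn' : (0 : ℝ) < n := by exact_mod_cast hn
  have hs := Real.mul_self_sqrt hn'.le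
  have := Real.sqrt_pos.2 hn'
  field_simp
  rw [sq, hs]

variable [NormedAddCommGroup E] [InnerProductSpace ℝ E] [CompleteSpace E]
  [SecondCountableTopology E] [MeasurableSpace E] [BorelSpace E]

/-- The central limit theorem in a separable Hilbert space. -/
theorem asymptoticallyGaussian_normalizedSum {ξ : ℕ → Ω → E} (hξ : MemLp (ξ 0) 2 P)
    (hindep : iIndepFun ξ P) (hident : ∀ i, IdentDistrib (ξ i) (ξ 0) P P) :
    AsymptoticallyGaussian P
      (fun (n : ℕ) ω => √(n : ℝ) • ((n : ℝ)⁻¹ • ∑ i ∈ Finset.range n, ξ i ω - P[ξ 0])) := by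
  set Z : ℕ → Ω → E :=
    fun n ω => √(n : ℝ) • ((n : ℝ)⁻¹ • ∑ i ∈ Finset.range n, ξ i ω - P[ξ 0]) with hZ
  have hint : Integrable (ξ 0) P := hξ.integrable (by norm_num)
  have hmeas (i : ℕ) : AEMeasurable (ξ i) P := (hident i).aemeasurable_fst
  have hZm (n : ℕ) : AEMeasurable (Z n) P := by
    have := Finset.aemeasurable_fun_sum (Finset.range n) fun i _ => hmeas i
    fun_prop
  let law (n : ℕ) : ProbabilityMeasure E := ⟨P.map (Z n), Measure.isProbabilityMeasure_map (hZm n)⟩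
  -- the real projections of the sample
  have hLξ (L : StrongDual ℝ E) : MemLp (fun ω => L (ξ 0 ω)) 2 P := L.comp_memLp' hξ
  have hLindep (L : StrongDual ℝ E) : iIndepFun (fun i ω => L (ξ i ω)) P :=
    hindep.comp (fun _ => L) fun _ => L.continuous.measurable
  have hLident (L : StrongDual ℝ E) (i : ℕ) :
      IdentDistrib (fun ω => L (ξ i ω)) (fun ω => L (ξ 0 ω)) P P :=
    (hident i).comp L.continuous.measurable
  have hLZ (L : StrongDual ℝ E) (n : ℕ) (ω : Ω) : L (Z n ω) =
      √(n : ℝ) * ((n : ℝ)⁻¹ * ∑ i ∈ Finset.range n, L (ξ i ω) - ∫ ω, L (ξ 0 ω) ∂P) := by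
    rw [hZ, L.integral_comp_comm hint]
    simp
  have htight : IsTightMeasureSet {((μ : ProbabilityMeasure E) : Measure E) | μ ∈ Set.range law} := by
    obtain ⟨s, b, -⟩ := exists_hilbertBasis ℝ E
    have := hilbertBasis_countable b
    refine isTightMeasureSet_of_tsum_secondMoment b
      (c := fun i => ∫⁻ ω, ‖inner ℝ (b i) (ξ 0 ω)‖ₑ ^ 2 ∂P) ?_ ?_
    · have hm := hmeas 0
      rw [← lintegral_tsum fun i => by fun_prop]
      simp_rw [← enorm_sq_eq_tsum b]
      have hfin := (hξ.integrable_norm_pow two_ne_zero).2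
      simpa [HasFiniteIntegral] using hfin.ne
    · rintro _ ⟨_, ⟨n, rfl⟩, rfl⟩ i
      change ∫⁻ x, ‖inner ℝ (b i) x‖ₑ ^ 2 ∂(P.map (Z n)) ≤ _
      rw [lintegral_map' (by fun_prop) (hZm n)]
      have hL := lintegral_enorm_normalizedSum_le (hLξ (innerSL ℝ (b i))) (hLindep _) (hLident _) n
      simp_rw [← hLZ (innerSL ℝ (b i)) n] at hL
      exact hL
  have hcomp := isCompact_closure_of_isTightMeasureSet htight
  have hmem (n : ℕ) : law n ∈ closure (Set.range law) := subset_closure ⟨n, rfl⟩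
  -- the one-dimensional marginals of a cluster point
  have hmarg (μ : ProbabilityMeasure E) (hμ : MapClusterPt μ atTop law) (L : StrongDual ℝ E) :
      (μ : Measure E).map L = gaussianReal 0 Var[fun ω => L (ξ 0 ω); P].toNNReal := by
    have hcl := hμ.continuousAt_comp
      (ProbabilityMeasure.continuous_map L.continuous).continuousAt
    have ht := (tendstoInDistribution_normalizedSum (hLξ L) (hLindep L) (hLident L)).tendsto
    have hcomp : (fun μ : ProbabilityMeasure E => μ.map L.continuous.aemeasurable) ∘ law =
        fun n => ⟨P.map fun ω => √(n : ℝ) * ((n : ℝ)⁻¹ * ∑ i ∈ Finset.range n, L (ξ i ω)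
          - ∫ ω, L (ξ 0 ω) ∂P), Measure.isProbabilityMeasure_map
            ((tendstoInDistribution_normalizedSum (hLξ L) (hLindep L) (hLident L)).forall_aemeasurable n)⟩ := by
      ext1 n
      refine Subtype.ext ?_
      simp_rw [← hLZ L n]
      exact AEMeasurable.map_map_of_aemeasurable L.continuous.aemeasurable (hZm n)
    rw [hcomp] at hcl
    -- The image laws under `L` converge to the Gaussian and also cluster at the image of `μ`;
    -- limits are unique in a Hausdorff space.
    have heq := @eq_of_nhds_neBot _ _ _ _ _ (hcl.clusterPt.mono ht)
    simpa using congrArg Subtype.val heq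
  obtain ⟨ν, -, hν⟩ := hcomp.exists_mapClusterPt_of_frequently (l := atTop) (f := law)
    (Filter.Frequently.of_forall hmem)
  have hgauss : IsGaussian (ν : Measure E) :=
    isGaussian_of_map_eq_gaussianReal fun L => ⟨_, _, hmarg ν hν L⟩
  refine ⟨ν, hgauss, fun L => ?_, hZm, aemeasurable_id, ?_⟩
  · have h := integral_map (μ := (ν : Measure E)) L.continuous.aemeasurable
      (f := fun x : ℝ => x) (by fun_prop)
    rw [hmarg ν hν L, integral_id_gaussianReal] at h
    exact h.symm
  · simp_rw [Measure.map_id]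
    -- A relatively compact sequence with a single cluster point converges; the marginals determine
    -- the characteristic functional, hence the cluster point.
    refine hcomp.tendsto_nhds_of_unique_mapClusterPt (Filter.Eventually.of_forall hmem)
      fun μ _ hμ => Subtype.ext ?_
    have hν' : (μ : Measure E) = ν := by
      refine Measure.ext_of_charFunDual (funext fun L => ?_)
      rw [charFunDual_eq_charFun_map_one, charFunDual_eq_charFun_map_one, hmarg μ hμ L,
        hmarg ν hν L]
    exact hν'

end CentralLimit

/-! ### The Hilbert space structure of the Hilbert–Schmidt operators -/

section HilbertSchmidt

variable {E : Type*} [NormedAddCommGroup E] [InnerProductSpace ℝ E] [CompleteSpace E]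

lemma lp_summable_norm_sq {ι E : Type*} [NormedAddCommGroup E] (a : lp (fun _ : ι => E) 2) :
    Summable fun i => ‖a i‖ ^ 2 := by
  simpa using (lp.memℓp a).summable (by norm_num)

lemma lp_norm_sq {ι E : Type*} [NormedAddCommGroup E] (a : lp (fun _ : ι => E) 2) :
    ‖a‖ ^ 2 = ∑' i, ‖a i‖ ^ 2 := by
  simpa using lp.norm_rpow_eq_tsum (p := 2) (by norm_num) a

omit [CompleteSpace E] in
lemma summable_norm_inner_smul {ι : Type*} (b : HilbertBasis ι ℝ E) (a : lp (fun _ : ι => E) 2)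
    (φ : E) : Summable fun i => ‖inner ℝ (b i) φ • a i‖ := by
  refine Summable.of_nonneg_of_le (fun i => norm_nonneg _) (fun i => ?_)
    ((hasSum_norm_inner_sq b φ).summable.add (lp_summable_norm_sq a))
  rw [norm_smul]
  nlinarith [sq_nonneg (‖inner ℝ (b i) φ‖ - ‖a i‖), sq_nonneg (‖inner ℝ (b i) φ‖ + ‖a i‖)]

omit [CompleteSpace E] in
-- Cauchy–Schwarz on finite sums. It bounds the operator rebuilt from a square-summable family, and
-- the operator norm by the Hilbert–Schmidt norm.
lemma norm_tsum_inner_smul_le {ι : Type*} (b : HilbertBasis ι ℝ E) (a : lp (fun _ : ι => E) 2)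
    (φ : E) : ‖∑' i, inner ℝ (b i) φ • a i‖ ≤ ‖a‖ * ‖φ‖ := by
  have hs := summable_norm_inner_smul b a φ
  refine (norm_tsum_le_tsum_norm hs).trans ?_
  refine Real.tsum_le_of_sum_le (fun i => norm_nonneg _) fun s => ?_
  refine abs_le_of_sq_le_sq' ?_ (by positivity) |>.2
  calc (∑ i ∈ s, ‖inner ℝ (b i) φ • a i‖) ^ 2
      = (∑ i ∈ s, ‖a i‖ * ‖inner ℝ (b i) φ‖) ^ 2 := by simp_rw [norm_smul, mul_comm]
    _ ≤ (∑ i ∈ s, ‖a i‖ ^ 2) * ∑ i ∈ s, ‖inner ℝ (b i) φ‖ ^ 2 := Finset.sum_mul_sq_le_sq_mul_sq ..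
    _ ≤ ‖a‖ ^ 2 * ‖φ‖ ^ 2 := by
        gcongr
        · rw [lp_norm_sq]
          exact (lp_summable_norm_sq a).sum_le_tsum s fun i _ => by positivity
        · rw [← (hasSum_norm_inner_sq b φ).tsum_eq]
          exact (hasSum_norm_inner_sq b φ).summable.sum_le_tsum s fun i _ => by positivity
    _ = (‖a‖ * ‖φ‖) ^ 2 := by ring

omit [CompleteSpace E] in
lemma tensor_add_left (u u' v : E) : tensor (u + u') v = tensor u v + tensor u' v := by
  ext φ; simp [tensor_apply, inner_add_left, add_smul]

omit [CompleteSpace E] in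
lemma tensor_smul_left (c : ℝ) (u v : E) : tensor (c • u) v = c • tensor u v := by
  ext φ; simp [tensor_apply, inner_smul_left, mul_smul]

omit [CompleteSpace E] in
lemma tensor_add_right (u v v' : E) : tensor u (v + v') = tensor u v + tensor u v' := by
  ext φ; simp [tensor_apply]

omit [CompleteSpace E] in
lemma tensor_smul_right (c : ℝ) (u v : E) : tensor u (c • v) = c • tensor u v := by
  ext φ; simp [tensor_apply, smul_comm c]

namespace HilbertSchmidt

lemma toLp_apply (A : HilbertSchmidt E) (i : basisIndex E) :
    toLp E A i = A.toCLM (someBasis E i) := rfl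

lemma norm_toLp (A : HilbertSchmidt E) : ‖toLp E A‖ = ‖A‖ := rfl

/-- The family `a` comes from `φ ↦ ∑ ⟪b i, φ⟫ a i`. Surjectivity transports completeness from `ℓ²`.
-/
lemma toLp_surjective : Function.Surjective (toLp E) := by
  intro a
  set b := someBasis E
  let A : E →L[ℝ] E := LinearMap.mkContinuous
    { toFun := fun φ => ∑' i, inner ℝ (b i) φ • a i
      map_add' := fun φ ψ => by
        simp_rw [inner_add_right, add_smul]
        exact (summable_norm_inner_smul b a φ).of_norm.tsum_add
          (summable_norm_inner_smul b a ψ).of_norm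
      map_smul' := fun c φ => by
        simp_rw [inner_smul_right, mul_smul]
        exact tsum_const_smul'' c }
    ‖a‖ fun φ => norm_tsum_inner_smul_le b a φ
  have hA (i) : A (b i) = a i := by
    classical
    change ∑' j, inner ℝ (b j) (b i) • a j = a i
    rw [tsum_eq_single i fun j hj => by rw [b.orthonormal.2 hj, zero_smul],
      real_inner_self_eq_norm_sq, b.orthonormal.1, one_pow, one_smul]
  refine ⟨⟨A, ?_⟩, ?_⟩
  · change Summable fun i => ‖A (b i)‖ ^ 2
    simp_rw [hA]
    exact lp_summable_norm_sq a
  · ext i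
    exact congrArg (fun x => x) (hA i)

noncomputable instance : InnerProductSpace ℝ (HilbertSchmidt E) where
  toNormedSpace := inferInstance
  inner A B := inner ℝ (toLp E A) (toLp E B)
  norm_sq_eq_re_inner A := by rw [← norm_toLp]; exact InnerProductSpace.norm_sq_eq_re_inner _
  conj_inner_symm A B := InnerProductSpace.conj_inner_symm _ _
  add_left A B C := by rw [map_add]; exact inner_add_left _ _ _
  smul_left A B c := by rw [map_smul]; exact inner_smul_left _ _ _

lemma inner_eq_tsum (A B : HilbertSchmidt E) :
    inner ℝ A B = ∑' i, inner ℝ (A.toCLM (someBasis E i)) (B.toCLM (someBasis E i)) :=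
  lp.inner_eq_tsum (toLp E A) (toLp E B)

variable (E) in
/-- The Hilbert–Schmidt operators are isometric to the square-summable families in `E`. -/
noncomputable def toLpEquiv : HilbertSchmidt E ≃ₗᵢ[ℝ] lp (fun _ : basisIndex E => E) 2 where
  toLinearEquiv := LinearEquiv.ofBijective (toLp E) ⟨toLp_injective, toLp_surjective⟩
  norm_map' := norm_toLp

instance : CompleteSpace (HilbertSchmidt E) :=
  (toLpEquiv E).isometry.isUniformInducing.completeSpace_congr
    (toLpEquiv E).surjective |>.2 inferInstance

lemma norm_toCLM_le (A : HilbertSchmidt E) : ‖A.toCLM‖ ≤ ‖A‖ := by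
  refine ContinuousLinearMap.opNorm_le_bound _ (norm_nonneg _) fun φ => ?_
  have h := ((someBasis E).hasSum_repr φ).mapL A.toCLM
  have h' : A.toCLM φ = ∑' i, inner ℝ (someBasis E i) φ • toLp E A i := by
    rw [← h.tsum_eq]
    simp [toLp_apply, HilbertBasis.repr_apply_apply]
  rw [h']
  exact norm_tsum_inner_smul_le _ _ _

variable (E) in
/-- The inclusion of the Hilbert–Schmidt operators into the bounded operators. -/
noncomputable def toCLML : HilbertSchmidt E →L[ℝ] (E →L[ℝ] E) :=
  LinearMap.mkContinuous
    { toFun := toCLM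
      map_add' := fun _ _ => rfl
      map_smul' := fun _ _ => rfl } 1 fun A => by rw [one_mul]; exact norm_toCLM_le A

@[simp] lemma toCLML_apply (A : HilbertSchmidt E) : toCLML E A = A.toCLM := rfl

/-- Parseval for `u`, since `(u ⊗ v) e_i = ⟪u, e_i⟫ v`. -/
lemma hasSum_norm_tensor_sq (u v : E) :
    HasSum (fun i => ‖CategoricalFDA.tensor u v (someBasis E i)‖ ^ 2) (‖u‖ ^ 2 * ‖v‖ ^ 2) := by
  simp_rw [tensor_apply, norm_smul, mul_pow, real_inner_comm _ u]
  exact (hasSum_norm_inner_sq (someBasis E) u).mul_right _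

variable (E) in
/-- The tensor product of two vectors as a Hilbert–Schmidt operator. -/
noncomputable def tensorL : E →L[ℝ] E →L[ℝ] HilbertSchmidt E :=
  LinearMap.mkContinuous₂
    (LinearMap.mk₂ ℝ (fun u v => (⟨CategoricalFDA.tensor u v,
        (hasSum_norm_tensor_sq u v).summable⟩ : HilbertSchmidt E))
      (fun u u' v => Subtype.ext (tensor_add_left u u' v))
      (fun c u v => Subtype.ext (tensor_smul_left c u v))
      (fun u v v' => Subtype.ext (tensor_add_right u v v'))
      (fun c u v => Subtype.ext (tensor_smul_right c u v)))
    1 fun u v => by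
      rw [one_mul]
      refine (abs_le_of_sq_le_sq' (le_of_eq ?_) (by positivity)).2
      rw [HilbertSchmidt.norm_sq, mul_pow]
      exact (hasSum_norm_tensor_sq u v).tsum_eq

@[simp] lemma toCLM_tensorL (u v : E) : (tensorL E u v).toCLM = CategoricalFDA.tensor u v := rfl

lemma norm_tensorL (u v : E) : ‖tensorL E u v‖ = ‖u‖ * ‖v‖ := by
  rw [← sq_eq_sq₀ (norm_nonneg _) (by positivity), HilbertSchmidt.norm_sq, mul_pow]
  exact (hasSum_norm_tensor_sq u v).tsum_eq

lemma inner_tensorL_basis (A : HilbertSchmidt E) (i : basisIndex E) (v : E) :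
    inner ℝ (tensorL E (someBasis E i) v) A = inner ℝ v (A.toCLM (someBasis E i)) := by
  classical
  rw [inner_eq_tsum, tsum_eq_single i]
  · rw [toCLM_tensorL, tensor_apply, real_inner_self_eq_norm_sq, (someBasis E).orthonormal.1,
      one_pow, one_smul]
  · intro j hj
    rw [toCLM_tensorL, tensor_apply, (someBasis E).orthonormal.2 hj.symm, zero_smul, inner_zero_left]

/-- The countably many `e_i ⊗ e_j` span a dense subspace: an operator orthogonal to all of them has
zero matrix entries. -/
instance [SecondCountableTopology E] : SecondCountableTopology (HilbertSchmidt E) := by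
  have := hilbertBasis_countable (someBasis E)
  set s : Set (HilbertSchmidt E) :=
    Set.range fun ij : basisIndex E × basisIndex E => tensorL E (someBasis E ij.1) (someBasis E ij.2)
  have hs : (Submodule.span ℝ s).topologicalClosure = ⊤ := by
    rw [Submodule.topologicalClosure_eq_top_iff, Submodule.eq_bot_iff]
    intro A hA
    refine toLp_injective ?_
    rw [map_zero]
    ext1
    funext i
    have h := hasSum_norm_inner_sq (someBasis E) (A.toCLM (someBasis E i))
    have h0 (j) : inner ℝ (someBasis E j) (A.toCLM (someBasis E i)) = 0 := by
      rw [← inner_tensorL_basis]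
      exact (Submodule.mem_orthogonal _ _).1 hA _ (Submodule.subset_span ⟨(i, j), rfl⟩)
    simp only [h0, norm_zero, ne_eq, OfNat.ofNat_ne_zero, not_false_eq_true, zero_pow] at h
    exact norm_eq_zero.1 (pow_eq_zero_iff two_ne_zero |>.1 (h.unique hasSum_zero))
  have hsep : TopologicalSpace.IsSeparable s := (Set.countable_range _).isSeparable
  have huniv : TopologicalSpace.IsSeparable (Set.univ : Set (HilbertSchmidt E)) := by
    have h := (hsep.span (R := ℝ)).closure
    rwa [← Submodule.topologicalClosure_coe, hs, Submodule.top_coe] at h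
  have := TopologicalSpace.isSeparable_univ_iff.1 huniv
  exact UniformSpace.secondCountable_of_separable _

end HilbertSchmidt

end HilbertSchmidt

/-! ### Empirical mean and covariance operator of a bounded i.i.d. sample in a Hilbert space -/

section Sample

variable {Ω E : Type*} [MeasurableSpace Ω] {P : Measure Ω} [IsProbabilityMeasure P]
  [NormedAddCommGroup E] [InnerProductSpace ℝ E] [CompleteSpace E]
  [SecondCountableTopology E] [MeasurableSpace E] [BorelSpace E]

/-- The scalar bound summed over the coordinates in a Hilbert basis. -/
lemma lintegral_enorm_sq_normalizedSum_le {ξ : ℕ → Ω → E} (hξ : MemLp (ξ 0) 2 P)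
    (hindep : iIndepFun ξ P) (hident : ∀ i, IdentDistrib (ξ i) (ξ 0) P P) (n : ℕ) :
    ∫⁻ ω, ‖√(n : ℝ) • ((n : ℝ)⁻¹ • ∑ i ∈ Finset.range n, ξ i ω - P[ξ 0])‖ₑ ^ 2 ∂P
      ≤ ∫⁻ ω, ‖ξ 0 ω‖ₑ ^ 2 ∂P := by
  obtain ⟨s, b, -⟩ := exists_hilbertBasis ℝ E
  have := hilbertBasis_countable b
  have hmeas (i : ℕ) : AEMeasurable (ξ i) P := (hident i).aemeasurable_fst
  have hm := hmeas 0
  have hs := Finset.aemeasurable_fun_sum (Finset.range n) fun i _ => hmeas i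
  simp_rw [enorm_sq_eq_tsum b]
  rw [lintegral_tsum fun i => by fun_prop, lintegral_tsum fun i => by fun_prop]
  refine ENNReal.tsum_le_tsum fun k => ?_
  have hL : Continuous fun x : E => inner ℝ (b k) x := by fun_prop
  have hle := lintegral_enorm_normalizedSum_le (P := P) (X := fun i ω => inner ℝ (b k) (ξ i ω))
    ((innerSL ℝ (b k)).comp_memLp' hξ) (hindep.comp _ fun _ => hL.measurable)
    (fun i => (hident i).comp hL.measurable) n
  simpa [inner_smul_right, inner_sub_right, inner_sum,
    integral_inner (hξ.integrable (by norm_num))] using hle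

/-- The sample mean of `X 0, …, X (n - 1)`. -/
noncomputable def sampleMean {F : Type*} [AddCommGroup F] [Module ℝ F] (X : ℕ → Ω → F)
    (n : ℕ) (ω : Ω) : F :=
  (n : ℝ)⁻¹ • ∑ i ∈ Finset.range n, X i ω

/-- The sample covariance of `X 0, …, X (n - 1)`, as a Hilbert–Schmidt operator. -/
noncomputable def sampleCov (X : ℕ → Ω → E) (n : ℕ) (ω : Ω) : HilbertSchmidt E :=
  sampleMean (fun i ω => HilbertSchmidt.tensorL E (X i ω) (X i ω)) n ω -
    HilbertSchmidt.tensorL E (sampleMean X n ω) (sampleMean X n ω)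

omit [MeasurableSpace Ω] [SecondCountableTopology E] [MeasurableSpace E] [BorelSpace E] in
-- Covariance is invariant under translation by `m`. The case `n = 0` is excluded because the mean
-- of an empty constant sample is `0`, not `m`.
lemma sampleCov_eq (X : ℕ → Ω → E) (m : E) {n : ℕ} (hn : n ≠ 0) (ω : Ω) :
    sampleCov X n ω =
      sampleMean (fun i ω => HilbertSchmidt.tensorL E (X i ω - m) (X i ω - m)) n ω -
        HilbertSchmidt.tensorL E (sampleMean X n ω - m) (sampleMean X n ω - m) := by
  have hn' : (n : ℝ) ≠ 0 := by exact_mod_cast hn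
  simp only [sampleCov, sampleMean, map_sub, _root_.sub_apply, Finset.sum_sub_distrib,
    smul_sub, Finset.sum_const, Finset.card_range, ← Nat.cast_smul_eq_nsmul ℝ, smul_smul,
    inv_mul_cancel₀ hn', one_smul, map_smul, map_sum, _root_.smul_apply,
    _root_.sum_apply]
  abel

variable {X : ℕ → Ω → E} {X₀ : Ω → E} {C : ℝ}

omit [SecondCountableTopology E] [MeasurableSpace E] [BorelSpace E] in
lemma continuous_centredSquare (m : E) :
    Continuous fun x : E => HilbertSchmidt.tensorL E (x - m) (x - m) := by
  fun_prop

omit [InnerProductSpace ℝ E] [CompleteSpace E] in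
lemma memLp_of_identDistrib_of_bound (hb : ∀ ω, ‖X₀ ω‖ ≤ C) {Z : Ω → E}
    (h : IdentDistrib Z X₀ P P) : MemLp Z 2 P :=
  h.memLp_iff.2 (MemLp.of_bound h.aemeasurable_snd.aestronglyMeasurable C (ae_of_all _ hb))

lemma ae_tendsto_sampleMean (hb : ∀ ω, ‖X₀ ω‖ ≤ C) (hindep : iIndepFun X P)
    (hident : ∀ i, IdentDistrib (X i) X₀ P P) :
    ∀ᵐ ω ∂P, Tendsto (fun n => sampleMean X n ω) atTop (𝓝 P[X₀]) := by
  have h := strong_law_ae X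
    ((memLp_of_identDistrib_of_bound hb (hident 0)).integrable (by norm_num))
    (fun i j hij => hindep.indepFun hij) (fun i => (hident i).trans (hident 0).symm)
  rwa [(hident 0).integral_eq] at h

lemma asymptoticallyGaussian_sampleMean (hb : ∀ ω, ‖X₀ ω‖ ≤ C) (hindep : iIndepFun X P)
    (hident : ∀ i, IdentDistrib (X i) X₀ P P) :
    AsymptoticallyGaussian P fun (n : ℕ) ω => √(n : ℝ) • (sampleMean X n ω - P[X₀]) := by
  have h := asymptoticallyGaussian_normalizedSum
    (memLp_of_identDistrib_of_bound hb (hident 0)) hindep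
    (fun i => (hident i).trans (hident 0).symm)
  rwa [(hident 0).integral_eq] at h

omit [MeasurableSpace Ω] [SecondCountableTopology E] [MeasurableSpace E] [BorelSpace E] in
lemma norm_centredSquare_le (hb : ∀ ω, ‖X₀ ω‖ ≤ C) (m : E) (ω : Ω) :
    ‖HilbertSchmidt.tensorL E (X₀ ω - m) (X₀ ω - m)‖ ≤ (C + ‖m‖) * (C + ‖m‖) := by
  rw [HilbertSchmidt.norm_tensorL]
  have h := (norm_sub_le (X₀ ω) m).trans (add_le_add_left (hb ω) ‖m‖)
  gcongr
  exact (norm_nonneg _).trans h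

lemma ae_tendsto_sampleCov (hb : ∀ ω, ‖X₀ ω‖ ≤ C) (hindep : iIndepFun X P)
    (hident : ∀ i, IdentDistrib (X i) X₀ P P) :
    ∀ᵐ ω ∂P, Tendsto (fun n => sampleCov X n ω) atTop
      (𝓝 (∫ ω, HilbertSchmidt.tensorL E (X₀ ω - P[X₀]) (X₀ ω - P[X₀]) ∂P)) := by
  have hc := continuous_centredSquare (P[X₀])
  filter_upwards [ae_tendsto_sampleMean hb hindep hident,
    ae_tendsto_sampleMean (norm_centredSquare_le hb P[X₀])
      (hindep.comp (fun _ => _) fun _ => hc.measurable)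
      fun i => (hident i).comp hc.measurable] with ω h1 h2
  have h3 := h2.sub ((hc.tendsto _).comp h1)
  simp only [sub_self, map_zero, sub_zero] at h3
  refine h3.congr' ?_
  filter_upwards [eventually_ne_atTop 0] with n hn
  exact (sampleCov_eq X _ hn ω).symm

/-- With `d` the error of the sample mean, the norm is `√n ‖d‖² = ‖√n d‖² / √n`, whose expectation
is `O(1 / √n)`. -/
lemma tendstoInMeasure_sqrt_smul_tensorL (hb : ∀ ω, ‖X₀ ω‖ ≤ C) (hindep : iIndepFun X P)
    (hident : ∀ i, IdentDistrib (X i) X₀ P P) :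
    TendstoInMeasure P (fun (n : ℕ) ω => √(n : ℝ) •
      HilbertSchmidt.tensorL E (sampleMean X n ω - P[X₀]) (sampleMean X n ω - P[X₀])) atTop 0 := by
  have hmeas (n : ℕ) : AEMeasurable (sampleMean X n) P :=
    (Finset.aemeasurable_fun_sum _ fun i _ => (hident i).aemeasurable_fst).const_smul _
  have hc := continuous_centredSquare (P[X₀])
  refine tendstoInMeasure_of_tendsto_eLpNorm one_ne_zero
    (fun n => ((hc.const_smul √(n : ℝ)).measurable.comp_aemeasurable
      (hmeas n)).aestronglyMeasurable)
    aestronglyMeasurable_zero ?_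
  have hK : ∫⁻ ω, ‖X 0 ω‖ₑ ^ 2 ∂P ≠ ∞ := by
    have hfin := ((memLp_of_identDistrib_of_bound hb (hident 0)).integrable_norm_pow two_ne_zero).2
    simpa [HasFiniteIntegral] using hfin.ne
  have hle (n : ℕ) : eLpNorm ((fun ω => √(n : ℝ) •
      HilbertSchmidt.tensorL E (sampleMean X n ω - P[X₀]) (sampleMean X n ω - P[X₀])) - 0) 1 P ≤
      ENNReal.ofReal (√(n : ℝ))⁻¹ * ∫⁻ ω, ‖X 0 ω‖ₑ ^ 2 ∂P := by
    rw [sub_zero, eLpNorm_one_eq_lintegral_enorm]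
    have h2 := lintegral_enorm_sq_normalizedSum_le
      (memLp_of_identDistrib_of_bound hb (hident 0)) hindep
      (fun i => (hident i).trans (hident 0).symm) n
    rw [(hident 0).integral_eq] at h2
    refine le_trans (le_of_eq ?_) (mul_le_mul_right h2 _)
    rw [← lintegral_const_mul' _ _ ENNReal.ofReal_ne_top]
    refine lintegral_congr fun ω => ?_
    rw [← ofReal_norm, ← ofReal_norm, ← ENNReal.ofReal_pow (norm_nonneg _),
      ← ENNReal.ofReal_mul (by positivity), norm_smul, norm_smul, HilbertSchmidt.norm_tensorL,
      Real.norm_of_nonneg (Real.sqrt_nonneg _)]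
    congr 1
    change √(n : ℝ) * (‖sampleMean X n ω - P[X₀]‖ * ‖sampleMean X n ω - P[X₀]‖) =
      (√(n : ℝ))⁻¹ * (√(n : ℝ) * ‖sampleMean X n ω - P[X₀]‖) ^ 2
    rcases eq_or_ne (√(n : ℝ)) 0 with h0 | h0
    · simp [h0]
    · field_simp
  refine tendsto_of_tendsto_of_tendsto_of_le_of_le tendsto_const_nhds ?_ (fun _ => zero_le)
    hle
  rw [← zero_mul (∫⁻ ω, ‖X 0 ω‖ₑ ^ 2 ∂P), ← ENNReal.ofReal_zero]
  refine ENNReal.Tendsto.mul_const (ENNReal.tendsto_ofReal ?_) (Or.inr hK)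
  exact tendsto_inv_atTop_zero.comp (Real.tendsto_sqrt_atTop.comp tendsto_natCast_atTop_atTop)

/-- Slutsky: the central limit theorem applies to the centred squares, and the quadratic correction
tends to zero in probability. -/
lemma asymptoticallyGaussian_sampleCov (hb : ∀ ω, ‖X₀ ω‖ ≤ C) (hindep : iIndepFun X P)
    (hident : ∀ i, IdentDistrib (X i) X₀ P P) :
    AsymptoticallyGaussian P fun (n : ℕ) ω => √(n : ℝ) • (sampleCov X n ω -
      ∫ ω, HilbertSchmidt.tensorL E (X₀ ω - P[X₀]) (X₀ ω - P[X₀]) ∂P) := by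
  have hc := continuous_centredSquare (P[X₀])
  obtain ⟨ν, hν, hν0, hlim⟩ := asymptoticallyGaussian_sampleMean
    (norm_centredSquare_le hb P[X₀])
    (hindep.comp (fun _ => _) fun _ => hc.measurable) fun i => (hident i).comp hc.measurable
  have hmeas (n : ℕ) : AEMeasurable (sampleMean X n) P :=
    (Finset.aemeasurable_fun_sum _ fun i _ => (hident i).aemeasurable_fst).const_smul _
  refine ⟨ν, hν, hν0, tendstoInDistribution_of_tendstoInMeasure_sub _ _ hlim ?_ fun n => ?_⟩
  · have hR := tendstoInMeasure_sqrt_smul_tensorL hb hindep hident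
    rw [tendstoInMeasure_iff_norm] at hR ⊢
    refine fun ε hε => (hR ε hε).congr fun n => ?_
    congr 1
    ext ω
    refine iff_of_eq (congrArg (ε ≤ ·) ?_)
    simp only [Pi.sub_apply, Pi.zero_apply, sub_zero]
    rcases eq_or_ne n 0 with rfl | hn
    · simp
    · rw [sampleCov_eq X P[X₀] hn, ← smul_sub]
      simp [norm_smul, Function.comp_def, -map_sub, sub_sub_sub_cancel_right, sub_sub_cancel_left]
  · have h1 : AEMeasurable (sampleCov X n) P := by
      have hc0 : Continuous fun x : E => HilbertSchmidt.tensorL E x x := by fun_prop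
      refine AEMeasurable.sub ?_ (hc0.measurable.comp_aemeasurable (hmeas n))
      exact (continuous_const_smul (n : ℝ)⁻¹).measurable.comp_aemeasurable
        (Finset.aemeasurable_fun_sum _ fun i _ =>
          hc0.measurable.comp_aemeasurable (hident i).aemeasurable_fst)
    exact (continuous_const_smul √(n : ℝ)).measurable.comp_aemeasurable (h1.sub_const _)

end Sample

/-! ### The weighted product space -/

section WeightedL2

variable {T : ℝ} {q : ℕ} {w : Fin q → ℝ}

instance : SecondCountableTopology (WeightedL2 T w) := by
  have (j : Fin q) : IsFiniteMeasure (ENNReal.ofReal (w j) • lebesgue T) :=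
    Measure.smul_finite _ ENNReal.ofReal_ne_top
  have : Fact ((2 : ℝ≥0∞) ≠ ∞) := ⟨by norm_num⟩
  have (j : Fin q) : SecondCountableTopology (Lp ℝ 2 (ENNReal.ofReal (w j) • lebesgue T)) :=
    inferInstance
  exact PiLp.secondCountableTopology 2 fun j : Fin q => Lp ℝ 2 (ENNReal.ofReal (w j) • lebesgue T)

lemma WeightedL2.component_sub (f g : WeightedL2 T w) (j : Fin q) :
    (f - g).component j = f.component j - g.component j := rfl

lemma ae_lebesgue_of_ae_smul (hw : ∀ j, 0 < w j) {j : Fin q} {p : Set.Icc (0 : ℝ) T → Prop}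
    (h : ∀ᵐ t ∂(ENNReal.ofReal (w j) • lebesgue T), p t) : ∀ᵐ t ∂lebesgue T, p t := by
  rw [ae_iff, Measure.smul_apply, smul_eq_mul, mul_eq_zero] at h
  exact h.resolve_left (ENNReal.ofReal_pos.2 (hw j)).ne'

lemma WeightedL2.component_ofBounded (hw : ∀ j, 0 < w j) {f : Fin q → Set.Icc (0 : ℝ) T → ℝ}
    (hf : ∀ j, Measurable (f j)) (hb : ∀ j t, ‖f j t‖ ≤ 1) (j : Fin q) :
    (WeightedL2.ofBounded T w f hf hb).component j =ᵐ[lebesgue T] f j :=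
  have : IsFiniteMeasure (ENNReal.ofReal (w j) • lebesgue T) :=
    Measure.smul_finite _ ENNReal.ofReal_ne_top
  ae_lebesgue_of_ae_smul hw
    (MemLp.of_bound (hf j).aestronglyMeasurable 1 (ae_of_all _ (hb j))).coeFn_toLp

lemma WeightedL2.integrable_component (hw : ∀ j, 0 < w j) (v : WeightedL2 T w) (j : Fin q) :
    Integrable (v.component j) (lebesgue T) := by
  have : IsFiniteMeasure (ENNReal.ofReal (w j) • lebesgue T) :=
    Measure.smul_finite _ ENNReal.ofReal_ne_top
  have h := (Lp.memLp (v.component j)).integrable (by norm_num)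
  exact (integrable_smul_measure (ENNReal.ofReal_pos.2 (hw j)).ne' ENNReal.ofReal_ne_top).1 h

lemma WeightedL2.inner_ofBounded (hw : ∀ j, 0 < w j) (v : WeightedL2 T w)
    {f : Fin q → Set.Icc (0 : ℝ) T → ℝ} (hf : ∀ j, Measurable (f j)) (hb : ∀ j t, ‖f j t‖ ≤ 1) :
    inner ℝ v (WeightedL2.ofBounded T w f hf hb) =
      ∑ j, w j * ∫ t, v.component j t * f j t ∂lebesgue T := by
  rw [WeightedL2.inner_eq hw]
  refine Finset.sum_congr rfl fun j _ => ?_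
  congr 1
  refine integral_congr_ae ?_
  filter_upwards [component_ofBounded hw hf hb j] with t ht
  rw [ht]

lemma WeightedL2.norm_ofBounded_sub_sq (hw : ∀ j, 0 < w j)
    {f g : Fin q → Set.Icc (0 : ℝ) T → ℝ} (hf : ∀ j, Measurable (f j)) (hfb : ∀ j t, ‖f j t‖ ≤ 1)
    (hg : ∀ j, Measurable (g j)) (hgb : ∀ j t, ‖g j t‖ ≤ 1) :
    ‖WeightedL2.ofBounded T w f hf hfb - WeightedL2.ofBounded T w g hg hgb‖ ^ 2 =
      ∑ j, w j * ∫ t, (f j t - g j t) ^ 2 ∂lebesgue T := by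
  rw [← real_inner_self_eq_norm_sq, WeightedL2.inner_eq hw]
  refine Finset.sum_congr rfl fun j _ => ?_
  congr 1
  refine integral_congr_ae ?_
  rw [component_sub]
  have hsub := ae_lebesgue_of_ae_smul hw (Lp.coeFn_sub
    ((WeightedL2.ofBounded T w f hf hfb).component j)
    ((WeightedL2.ofBounded T w g hg hgb).component j))
  filter_upwards [component_ofBounded hw hf hfb j, component_ofBounded hw hg hgb j, hsub]
    with t h1 h2 h3
  rw [h3, Pi.sub_apply, h1, h2, sq]

lemma WeightedL2.norm_ofBounded_sq_le (hw : ∀ j, 0 < w j)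
    {f : Fin q → Set.Icc (0 : ℝ) T → ℝ} (hf : ∀ j, Measurable (f j)) (hb : ∀ j t, ‖f j t‖ ≤ 1) :
    ‖WeightedL2.ofBounded T w f hf hb‖ ^ 2 ≤ ∑ j, w j * (lebesgue T).real Set.univ := by
  have h := norm_ofBounded_sub_sq hw hf hb (g := fun _ _ => 0) (fun _ => measurable_const)
    (fun _ _ => by simp)
  have h0 : WeightedL2.ofBounded T w (fun _ _ => (0 : ℝ)) (fun _ => measurable_const)
    (fun _ _ => by simp) = 0 := rfl
  rw [h0, sub_zero] at h
  rw [h]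
  refine Finset.sum_le_sum fun j _ => mul_le_mul_of_nonneg_left ?_ (hw j).le
  have hle : ∫ t, (f j t - 0) ^ 2 ∂lebesgue T ≤ ∫ _, (1 : ℝ) ∂lebesgue T := by
    refine integral_mono_of_nonneg (ae_of_all _ fun t => by positivity) (integrable_const _)
      (ae_of_all _ fun t => ?_)
    have := hb j t
    simp only [sub_zero]
    rw [← sq_abs, ← Real.norm_eq_abs]
    nlinarith [norm_nonneg (f j t)]
  simpa using hle

end WeightedL2

/-! ### Trajectories -/

section Trajectory

variable {T : ℝ} {q : ℕ} {w : Fin q → ℝ}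

/-- The vector of binary trajectories of a measurable trajectory `y`. -/
noncomputable def binaryElement (w : Fin q → ℝ) (y : Set.Icc (0 : ℝ) T → Fin q)
    (hy : Measurable y) : WeightedL2 T w :=
  WeightedL2.ofBounded T w (fun j t => if y t = j then 1 else 0)
    (fun j => Measurable.ite (hy (measurableSet_singleton j)) measurable_const measurable_const)
    (fun j t => by split_ifs <;> simp)

/-- Two indicators of the same state differ by at most `1`, and only where `y ≠ z`. Fubini can then
exchange time with probability. -/
lemma enorm_binaryElement_sub_sq_le (hw : ∀ j, 0 < w j) {y z : Set.Icc (0 : ℝ) T → Fin q}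
    (hy : Measurable y) (hz : Measurable z) :
    ‖binaryElement w y hy - binaryElement w z hz‖ₑ ^ 2 ≤
      ENNReal.ofReal (∑ j, w j) * lebesgue T {t | y t ≠ z t} := by
  have hS : MeasurableSet {t | y t ≠ z t} := (measurableSet_eq_fun hy hz).compl
  have hle : ‖binaryElement w y hy - binaryElement w z hz‖ ^ 2 ≤
      (∑ j, w j) * (lebesgue T).real {t | y t ≠ z t} := by
    rw [binaryElement, binaryElement, WeightedL2.norm_ofBounded_sub_sq hw, Finset.sum_mul]
    refine Finset.sum_le_sum fun j _ => mul_le_mul_of_nonneg_left ?_ (hw j).le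
    rw [← integral_indicator_one hS]
    refine integral_mono_of_nonneg (ae_of_all _ fun t => by positivity)
      ((integrable_const 1).indicator hS) (ae_of_all _ fun t => ?_)
    by_cases h : y t = z t
    · simp [h]
    · have : t ∈ {t | y t ≠ z t} := h
      rw [Set.indicator_of_mem this]
      dsimp only
      split_ifs <;> simp
  rw [← ofReal_norm, ← ENNReal.ofReal_pow (norm_nonneg _)]
  refine (ENNReal.ofReal_le_ofReal hle).trans_eq ?_
  rw [ENNReal.ofReal_mul (Finset.sum_nonneg fun j _ => (hw j).le), ofReal_measureReal]

/-- The binary trajectories of the trajectory `y` discretized by the simple function `s`. -/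
noncomputable def discretized (w : Fin q → ℝ)
    (s : SimpleFunc (Set.Icc (0 : ℝ) T) (Set.Icc (0 : ℝ) T)) (y : Set.Icc (0 : ℝ) T → Fin q) :
    WeightedL2 T w :=
  -- Composing with a simple function makes any `y` measurable, so all trajectories are admitted.
  binaryElement w (fun t => y (s t)) (s.map y).measurable

/-- Only the values of `y` on the finite range of `s` matter, and they range over a finite set. -/
lemma measurable_discretized (w : Fin q → ℝ)
    (s : SimpleFunc (Set.Icc (0 : ℝ) T) (Set.Icc (0 : ℝ) T)) :
    Measurable (discretized w s) := by
  have hs (z : s.range → Fin q) : Measurable fun t => z ⟨s t, s.mem_range_self t⟩ :=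
    (measurable_of_finite z).comp (s.measurable.subtype_mk)
  have h : discretized w s =
      (fun z : s.range → Fin q => binaryElement w _ (hs z)) ∘ fun y a => y a := rfl
  rw [h]
  exact (measurable_of_finite _).comp (measurable_pi_lambda _ fun a => measurable_pi_apply _)

end Trajectory

/-! ### The random element of a categorical process -/

section RandomElement

variable {Ω : Type*} [MeasurableSpace Ω] {T : ℝ} {q : ℕ} {w : Fin q → ℝ}

namespace CategoricalProcess

variable (Y : CategoricalProcess Ω T q)

lemma measurable_trajectory (ω : Ω) : Measurable (Y.toFun ω) :=
  Y.measurable_uncurry.comp measurable_prodMk_left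

lemma measurable_state (t : Set.Icc (0 : ℝ) T) : Measurable fun ω => Y.toFun ω t :=
  Y.measurable_uncurry.comp measurable_prodMk_right

lemma measurable_toFun : Measurable Y.toFun :=
  measurable_pi_lambda _ Y.measurable_state

lemma X_eq_binaryElement (ω : Ω) :
    Y.X w ω = binaryElement w (Y.toFun ω) (Y.measurable_trajectory ω) :=
  rfl

variable {P : Measure Ω} [IsProbabilityMeasure P] {Y}

/-- If the discretizations `s m` converge pointwise to the identity, the discretized binary
trajectories of a process that is continuous in probability converge in probability. -/
lemma tendstoInMeasure_discretized (hw : ∀ j, 0 < w j) (hc : Y.ContinuousInProbability P)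
    {s : ℕ → SimpleFunc (Set.Icc (0 : ℝ) T) (Set.Icc (0 : ℝ) T)}
    (hs : ∀ t, Tendsto (fun m => s m t) atTop (𝓝 t)) :
    TendstoInMeasure P (fun m ω => discretized w (s m) (Y.toFun ω)) atTop (Y.X w) := by
  have hmeas (m : ℕ) : MeasurableSet
      {x : Ω × Set.Icc (0 : ℝ) T | Y.toFun x.1 x.2 ≠ Y.toFun x.1 (s m x.2)} :=
    (measurableSet_eq_fun Y.measurable_uncurry (Y.measurable_uncurry.comp
      (measurable_fst.prodMk ((s m).measurable.comp measurable_snd)))).compl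
  -- By Fubini this is the time integral of `ℙ(Y t ≠ Y (s m t))`, which tends to zero pointwise by
  -- continuity in probability and is dominated by `1`.
  have hrate : Tendsto (fun m => ∫⁻ ω, lebesgue T {t | Y.toFun ω t ≠ Y.toFun ω (s m t)} ∂P) atTop
      (𝓝 0) := by
    have hswap (m : ℕ) : ∫⁻ ω, lebesgue T {t | Y.toFun ω t ≠ Y.toFun ω (s m t)} ∂P =
        ∫⁻ t, P {ω | Y.toFun ω t ≠ Y.toFun ω (s m t)} ∂lebesgue T :=
      (Measure.prod_apply (hmeas m)).symm.trans (Measure.prod_apply_symm (hmeas m))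
    simp_rw [hswap]
    have h := tendsto_lintegral_of_dominated_convergence (μ := lebesgue T) (fun _ => 1)
      (F := fun m t => P {ω | Y.toFun ω t ≠ Y.toFun ω (s m t)}) (f := fun _ => 0)
      (fun m => measurable_measure_prodMk_right (hmeas m))
      (fun m => ae_of_all _ fun t => prob_le_one) (by simp)
      (ae_of_all _ fun t => (hc t).comp (hs t))
    simpa using h
  intro ε hε
  rcases eq_or_ne ε ∞ with rfl | hε'
  · simp [edist_ne_top]
  have hK : Tendsto (fun m => ENNReal.ofReal (∑ j, w j) *
      (∫⁻ ω, lebesgue T {t | Y.toFun ω t ≠ Y.toFun ω (s m t)} ∂P) / ε ^ 2) atTop (𝓝 0) := by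
    have h := ENNReal.Tendsto.div_const (ENNReal.Tendsto.const_mul hrate
      (a := ENNReal.ofReal (∑ j, w j)) (Or.inr ENNReal.ofReal_ne_top)) (b := ε ^ 2)
      (Or.inr (by positivity))
    simpa using h
  refine tendsto_of_tendsto_of_tendsto_of_le_of_le tendsto_const_nhds hK (fun _ => zero_le)
    fun m => ?_
  have hm : Measurable fun ω => lebesgue T {t | Y.toFun ω t ≠ Y.toFun ω (s m t)} :=
    measurable_measure_prodMk_left (hmeas m)
  dsimp only
  rw [← lintegral_const_mul _ hm]
  refine le_trans (measure_mono fun ω hω => ?_) (meas_ge_le_lintegral_div (ε := ε ^ 2)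
    (hm.const_mul _).aemeasurable (by positivity)
    (ENNReal.pow_ne_top hε'))
  have hω' : ε ≤ edist (discretized w (s m) (Y.toFun ω)) (Y.X w ω) := hω
  rw [edist_comm, edist_eq_enorm_sub, X_eq_binaryElement] at hω'
  exact (pow_le_pow_left₀ zero_le hω' 2).trans (enorm_binaryElement_sub_sq_le hw _ _)

omit [IsProbabilityMeasure P] in
-- Disagreement at two fixed times is an event of the product σ-algebra, so its probability depends
-- only on the law.
lemma continuousInProbability_of_identDistrib {Y' : CategoricalProcess Ω T q}
    (h : IdentDistrib Y'.toFun Y.toFun P P) (hc : Y.ContinuousInProbability P) :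
    Y'.ContinuousInProbability P := by
  intro t
  refine (hc t).congr fun s => ?_
  have hS : MeasurableSet {y : Set.Icc (0 : ℝ) T → Fin q | y t ≠ y s} :=
    (measurableSet_eq_fun (measurable_pi_apply t) (measurable_pi_apply s)).compl
  exact (h.measure_mem_eq hS).symm

/-- The random element `X` is almost surely a measurable function of the trajectory, with respect
to the product σ-algebra; the function only depends on the law of the process. -/
lemma exists_measurable_X_ae_eq (hT : 0 ≤ T) (hw : ∀ j, 0 < w j)
    (hc : Y.ContinuousInProbability P) :
    ∃ G : (Set.Icc (0 : ℝ) T → Fin q) → WeightedL2 T w, Measurable G ∧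
      ∀ Y' : CategoricalProcess Ω T q, IdentDistrib Y'.toFun Y.toFun P P →
        G ∘ Y'.toFun =ᵐ[P] Y'.X w := by
  let s (m : ℕ) : SimpleFunc (Set.Icc (0 : ℝ) T) (Set.Icc (0 : ℝ) T) :=
    SimpleFunc.approxOn id measurable_id Set.univ
      ⟨0, le_rfl, hT⟩ (Set.mem_univ _) m
  have hs (t) : Tendsto (fun m => s m t) atTop (𝓝 t) :=
    SimpleFunc.tendsto_approxOn measurable_id (Set.mem_univ _) (by simp)
  obtain ⟨ns, hns, hlim⟩ := (tendstoInMeasure_discretized hw hc hs).exists_seq_tendsto_ae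
  have hmeas (k : ℕ) : Measurable (discretized w (s (ns k))) := measurable_discretized _ _
  have hex : ∀ᵐ y ∂(P.map Y.toFun), ∃ l, Tendsto (fun k => discretized w (s (ns k)) y) atTop (𝓝 l) := by
    rw [ae_map_iff Y.measurable_toFun.aemeasurable (measurableSet_exists_tendsto hmeas)]
    filter_upwards [hlim] with ω hω using ⟨_, hω⟩
  obtain ⟨G, hG, hGlim⟩ := measurable_limit_of_tendsto_metrizable_ae
    (fun k => (hmeas k).aemeasurable) hex
  refine ⟨G, hG, fun Y' hY' => ?_⟩
  -- For any copy, the subsequence chosen for `Y` converges in probability to `Y'.X`, and almost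
  -- surely to `G ∘ Y'` because the laws agree. The two limits coincide almost surely.
  have h1 : TendstoInMeasure P (fun k ω => discretized w (s (ns k)) (Y'.toFun ω)) atTop (Y'.X w) :=
    (tendstoInMeasure_discretized hw (continuousInProbability_of_identDistrib hY' hc) hs).comp
      hns.tendsto_atTop
  rw [← hY'.map_eq] at hGlim
  have h2 : TendstoInMeasure P (fun k ω => discretized w (s (ns k)) (Y'.toFun ω)) atTop
      (G ∘ Y'.toFun) :=
    tendstoInMeasure_of_tendsto_ae
      (fun k => ((hmeas k).comp Y'.measurable_toFun).aestronglyMeasurable)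
      (ae_of_ae_map Y'.measurable_toFun.aemeasurable hGlim)
  exact tendstoInMeasure_ae_unique h2 h1

lemma norm_X_le (hw : ∀ j, 0 < w j) (ω : Ω) :
    ‖Y.X w ω‖ ≤ √(∑ j, w j * (lebesgue T).real Set.univ) :=
  Real.le_sqrt_of_sq_le (WeightedL2.norm_ofBounded_sq_le hw _ _)

/-- Tested against a vector `v`, this is Fubini between expectation and time integral, with `𝔼 1{Y t
= j} = ℙ(Y t = j)`. -/
lemma integral_X (hw : ∀ j, 0 < w j) (hX : AEMeasurable (Y.X w) P) : P[Y.X w] = Y.p P w := by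
  have hint : Integrable (Y.X w) P :=
    (MemLp.of_bound hX.aestronglyMeasurable _ (ae_of_all _ (norm_X_le hw))).integrable le_top
  refine ext_inner_left ℝ fun v => ?_
  have hp : inner ℝ v (Y.p P w) = ∑ j, w j * ∫ t, v.component j t * Y.prob P j t ∂lebesgue T :=
    WeightedL2.inner_ofBounded hw v _ _
  rw [← integral_inner hint, hp]
  have hX' (ω : Ω) : inner ℝ v (Y.X w ω) =
      ∑ j, w j * ∫ t, v.component j t * Y.binary ω j t ∂lebesgue T :=
    WeightedL2.inner_ofBounded hw v _ _
  have hb (j : Fin q) : Measurable fun x : Ω × Set.Icc (0 : ℝ) T => Y.binary x.1 j x.2 :=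
    Measurable.ite (Y.measurable_uncurry (measurableSet_singleton j)) measurable_const
      measurable_const
  have hprod (j : Fin q) : Integrable (fun x : Ω × Set.Icc (0 : ℝ) T =>
      v.component j x.2 * Y.binary x.1 j x.2) (P.prod (lebesgue T)) := by
    refine ((WeightedL2.integrable_component hw v j).comp_snd P).mul_bdd (c := 1)
      (hb j).aestronglyMeasurable (ae_of_all _ fun x => ?_)
    unfold binary
    split_ifs <;> simp
  simp_rw [hX']
  rw [integral_finsetSum _ fun j _ => ((hprod j).integral_prod_left).const_mul _]
  refine Finset.sum_congr rfl fun j _ => ?_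
  rw [integral_const_mul, integral_integral_swap (hprod j)]
  congr 1
  refine integral_congr_ae (ae_of_all _ fun t => ?_)
  dsimp only
  rw [integral_const_mul]
  congr 1
  have hS : MeasurableSet {ω | Y.toFun ω t = j} := Y.measurable_state t (measurableSet_singleton j)
  rw [prob, ← integral_indicator_one hS]
  refine integral_congr_ae (ae_of_all _ fun ω => ?_)
  simp [binary, Set.indicator_apply]

end CategoricalProcess

end RandomElement

end CategoricalFDA

/-! ### Transfer to categorical trajectories -/

open CategoricalFDA in
theorem proposition2 {Ω : Type*} [MeasurableSpace Ω] (P : Measure Ω) [IsProbabilityMeasure P]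
    (T : ℝ) (hT : 0 < T) (q : ℕ) (w : Fin q → ℝ) (hw : ∀ j, 0 < w j)
    (Y₀ : CategoricalProcess Ω T q) (H1 : Y₀.ContinuousInProbability P)
    (Y : ℕ → CategoricalProcess Ω T q) (hY : IsIIDSample P Y₀ Y) :
    (∀ᵐ ω ∂P, Tendsto (fun n => ‖empiricalMean Y w n ω - Y₀.p P w‖) atTop (𝓝 0)) ∧
    (∀ᵐ ω ∂P, Tendsto (fun n => ‖empiricalCov Y w n ω - Y₀.Γ P w‖) atTop (𝓝 0)) ∧
    AsymptoticallyGaussian P (fun n ω => √(n : ℝ) • (empiricalMean Y w n ω - Y₀.p P w)) ∧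
    ∃ D : ℕ → Ω → HilbertSchmidt (WeightedL2 T w),
      (∀ n ω, (D n ω).toCLM = √(n : ℝ) • (empiricalCov Y w n ω - Y₀.Γ P w)) ∧
      AsymptoticallyGaussian P D := by
  obtain ⟨G, hG, hGX⟩ := CategoricalProcess.exists_measurable_X_ae_eq hT.le hw H1 (w := w)
  have hGX₀ := hGX Y₀ (IdentDistrib.refl Y₀.measurable_toFun.aemeasurable)
  have hGXi (i : ℕ) := hGX (Y i) (hY.identDistrib i)
  have hX₀ : AEMeasurable (Y₀.X w) P := (hG.comp Y₀.measurable_toFun).aemeasurable.congr hGX₀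
  have hXi (i : ℕ) : AEMeasurable ((Y i).X w) P :=
    (hG.comp (Y i).measurable_toFun).aemeasurable.congr (hGXi i)
  -- Independence passes through the common measurable map `G`, then to `X` by almost sure equality.
  have hindep : iIndepFun (fun i => (Y i).X w) P :=
    (hY.indep.comp (fun _ => G) fun _ => hG).congr hGXi
  have hident (i : ℕ) : IdentDistrib ((Y i).X w) (Y₀.X w) P P :=
    ((IdentDistrib.of_ae_eq (hXi i) (hGXi i).symm).trans ((hY.identDistrib i).comp hG)).trans
      (IdentDistrib.of_ae_eq (hG.comp Y₀.measurable_toFun).aemeasurable hGX₀)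
  have hb := CategoricalProcess.norm_X_le (Y := Y₀) hw
  have hp := CategoricalProcess.integral_X hw hX₀
  have hc := continuous_centredSquare (E := WeightedL2 T w) (P[Y₀.X w])
  -- `Γ` is an integral in the bounded operators. The continuous inclusion of the Hilbert–Schmidt
  -- operators commutes with it, so `Γ` is itself Hilbert–Schmidt.
  have hΓ : Y₀.Γ P w = (∫ ω, HilbertSchmidt.tensorL _ (Y₀.X w ω - P[Y₀.X w])
      (Y₀.X w ω - P[Y₀.X w]) ∂P).toCLM := by
    have hint : Integrable (fun ω => HilbertSchmidt.tensorL _ (Y₀.X w ω - P[Y₀.X w])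
        (Y₀.X w ω - P[Y₀.X w])) P :=
      (MemLp.of_bound (hc.measurable.comp_aemeasurable hX₀).aestronglyMeasurable _
        (ae_of_all _ (norm_centredSquare_le hb _))).integrable le_top
    have h := (HilbertSchmidt.toCLML _).integral_comp_comm hint
    rw [HilbertSchmidt.toCLML_apply] at h
    rw [← h, CategoricalProcess.Γ, hp]
    rfl
  have hcov (n : ℕ) (ω : Ω) :
      empiricalCov Y w n ω = (sampleCov (fun i => (Y i).X w) n ω).toCLM := by
    rw [← HilbertSchmidt.toCLML_apply, sampleCov, map_sub, sampleMean, map_smul, map_sum]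
    rfl
  refine ⟨?_, ?_, ?_, fun n ω => √(n : ℝ) • (sampleCov (fun i => (Y i).X w) n ω -
    ∫ ω, HilbertSchmidt.tensorL _ (Y₀.X w ω - P[Y₀.X w]) (Y₀.X w ω - P[Y₀.X w]) ∂P),
    fun n ω => ?_, asymptoticallyGaussian_sampleCov hb hindep hident⟩
  · filter_upwards [ae_tendsto_sampleMean hb hindep hident] with ω hω
    rw [hp] at hω
    exact tendsto_iff_norm_sub_tendsto_zero.1 hω
  · filter_upwards [ae_tendsto_sampleCov hb hindep hident] with ω hω
    have h := tendsto_iff_norm_sub_tendsto_zero.1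
      (((HilbertSchmidt.toCLML _).continuous.tendsto _).comp hω)
    simp_rw [hcov, hΓ]
    exact h
  · have h := asymptoticallyGaussian_sampleMean hb hindep hident
    rw [hp] at h
    exact h
  · rw [hcov, hΓ]
    rfl
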